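/- Let $d\ge 0$ be an integer and let $C(\mathbb{R}^{2d})$ be the real vector space of all continuous functions $f:\mathbb{R}^{2d}\to\mathbb{R}$, where $\mathbb{R}^{2d}=\mathbb{R}^d\times\mathbb{R}^d$. Let $$\mathrm{Sp}(2d,\mathbb{R})=\{P\in \mathrm{GL}(2d,\mathbb{R}) : P^{T}\Omega_d P=\Omega_d\},\qquad \Omega_d=\begin{pmatrix}0 & I_d\\ -I_d & 0\end{pmatrix}.$$ Let $V\subseteq C(\mathbb{R}^{2d})$ be a finite-dimensional real linear subspace such that - for every $f\in V$ and every $h\in\mathbb{R}^{2d}$, the function $x\mapsto f(x+h)$ belongs to $V$, and - for every $f\in V$ and every $P\in \mathrm{Sp}(2d,\mathbb{R})$, the function $x\mapsto f(Px)$ belongs to $V$. Then every $f\in V$ is an ordinary polynomial in $2d$ real variables: there is $p\in\mathbb{R}[x_1,\dots,x_{2d}]$ with $f(x)=p(x)$ for all $x\in\mathbb{R}^{2d}$. -/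

import Mathlib

/-- The translation operator `τ_h` on real-valued continuous functions: `(τ_h f)(x) = f (x + h)`. -/
def translationOp {ι : Type*} (h : ι → ℝ) (f : C(ι → ℝ, ℝ)) : C(ι → ℝ, ℝ) where
  toFun x := f (x + h)

/-- The change of variables `O_P` by a square matrix `P`: `(O_P f)(x) = f (P x)`. -/
def matrixOp {ι : Type*} [Fintype ι] (P : Matrix ι ι ℝ) (f : C(ι → ℝ, ℝ)) : C(ι → ℝ, ℝ) where
  toFun x := f (P.mulVec x)
  continuous_toFun := f.continuous.comp (continuous_const.matrix_mulVec continuous_id)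

/-- `V` is translation invariant: `τ_h(V) ⊆ V` for all vectors `h`. -/
def TranslationInvariant {ι : Type*} (V : Submodule ℝ C(ι → ℝ, ℝ)) : Prop :=
  ∀ h : ι → ℝ, ∀ f ∈ V, translationOp h f ∈ V

/-- `V` is invariant by the elements of the real symplectic group `Sp(2d, ℝ)`: `O_P(V) ⊆ V` for
all `P ∈ Sp(2d, ℝ)`. The space `ℝ^{2d} = ℝ^d × ℝ^d` has its coordinates indexed by
`Fin d ⊕ Fin d`. Mathlib's symplectic group is defined by `P * J * Pᵀ = J`, equivalently
`Pᵀ * J * P = J`, with `J = [[0, -I], [I, 0]]`; replacing `J` by `-J` gives the same group. -/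
def SymplecticInvariant {d : ℕ} (V : Submodule ℝ C(Fin d ⊕ Fin d → ℝ, ℝ)) : Prop :=
  ∀ P ∈ Matrix.symplecticGroup (Fin d) ℝ, ∀ f ∈ V, matrixOp P f ∈ V

/-- `f` is an ordinary polynomial function of the coordinates. -/
def IsOrdinaryPolynomial {ι : Type*} (f : C(ι → ℝ, ℝ)) : Prop :=
  ∃ p : MvPolynomial ι ℝ, ∀ x : ι → ℝ, f x = MvPolynomial.eval x p

/-! Translation by h along a coordinate axis acts on V as an invertible operator T. Its n-th root,
translation by h/n, is conjugate to T through a symplectic dilation diag(c, c⁻¹). So the finite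
complex spectrum of T equals its own set of n-th powers for every n ≥ 1, which forces it into {1},
and T - 1 is nilpotent. Hence the iterated difference of order dim V kills every f in V along each
axis. Fréchet's theorem makes f a polynomial of bounded degree in each variable separately, and
interpolating one variable at a time makes it a polynomial jointly. -/

/-! ### Unipotence from conjugate roots -/

open Polynomial in
theorem Module.End.isNilpotent_of_spectrum_subset {K W : Type*} [Field K] [IsAlgClosed K]
    [AddCommGroup W] [Module K W] [FiniteDimensional K W] (T : Module.End K W)
    (h : spectrum K T ⊆ {0}) : IsNilpotent T := by
  have hs : T.charpoly.roots = Multiset.replicate T.charpoly.roots.card 0 := by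
    refine Multiset.eq_replicate.2 ⟨rfl, fun μ hμ => ?_⟩
    have hμ' : T.HasEigenvalue μ :=
      (Module.End.hasEigenvalue_iff_isRoot_charpoly T μ).2 (isRoot_of_mem_roots hμ)
    exact h hμ'.mem_spectrum
  have hp := (IsAlgClosed.splits T.charpoly).eq_prod_roots_of_monic T.charpoly_monic
  rw [hs, Multiset.map_replicate, Multiset.prod_replicate, C_0, sub_zero] at hp
  refine ⟨T.charpoly.roots.card, ?_⟩
  have := LinearMap.aeval_self_charpoly T
  rwa [hp, map_pow, aeval_X] at this

/-- A finite set of nonzero scalars that is closed under all powers consists of roots of unity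
of a common order. -/
theorem Set.Finite.exists_pow_eq_one {K : Type*} [Field K] {s : Set K} (hs : s.Finite)
    (h0 : (0 : K) ∉ s) (hpow : ∀ μ ∈ s, ∀ n : ℕ, 0 < n → μ ^ n ∈ s) :
    ∃ N : ℕ, 0 < N ∧ ∀ μ ∈ s, μ ^ N = 1 := by
  have hone : ∀ μ ∈ s, IsOfFinOrder μ := by
    intro μ hμ
    obtain ⟨a, -, b, -, hab, h⟩ := Set.infinite_univ.exists_ne_map_eq_of_mapsTo
      (f := fun n : ℕ => μ ^ (n + 1)) (fun n _ => hpow μ hμ (n + 1) n.succ_pos) hs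
    have hμ0 : μ ≠ 0 := fun h => h0 (h ▸ hμ)
    have hu : IsOfFinOrder (Units.mk0 μ hμ0) := by
      by_contra hinf
      rw [← injective_pow_iff_not_isOfFinOrder] at hinf
      have := @hinf (a + 1) (b + 1) (Units.ext (by simpa using h))
      omega
    exact MonoidHom.isOfFinOrder (Units.coeHom K) hu
  refine ⟨∏ μ ∈ hs.toFinset, orderOf μ,
    Finset.prod_pos fun μ hμ => (hone μ (hs.mem_toFinset.1 hμ)).orderOf_pos, fun μ hμ => ?_⟩
  exact orderOf_dvd_iff_pow_eq_one.1 (Finset.dvd_prod_of_mem _ (hs.mem_toFinset.2 hμ))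

/-- An invertible operator that has, for every `n ≥ 1`, an `n`-th root conjugate to itself is
unipotent (over an algebraically closed field). -/
theorem Module.End.isNilpotent_sub_one_of_roots_of_isAlgClosed {K W : Type*} [Field K]
    [IsAlgClosed K] [AddCommGroup W] [Module K W] [FiniteDimensional K W] (T : Module.End K W)
    (hT : IsUnit T) (S : ℕ → Module.End K W) (U : ℕ → (Module.End K W)ˣ)
    (hS : ∀ n, 0 < n → S n ^ n = T) (hU : ∀ n, 0 < n → S n = U n * T * ↑(U n)⁻¹) :
    IsNilpotent (T - 1) := by
  have hspec : ∀ n, 0 < n → spectrum K (S n) = spectrum K T := fun n hn => by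
    rw [hU n hn, spectrum.units_conjugate]
  have hpow : ∀ n, 0 < n → spectrum K T = (· ^ n) '' spectrum K T := fun n hn => by
    conv_lhs => rw [← hS n hn, spectrum.map_pow_of_pos _ hn, hspec n hn]
  obtain ⟨N, hN, h1⟩ := (Module.End.finite_spectrum T).exists_pow_eq_one
    ((spectrum.zero_notMem_iff K).2 hT)
    (fun μ hμ n hn => by rw [hpow n hn]; exact ⟨μ, hμ, rfl⟩)
  apply Module.End.isNilpotent_of_spectrum_subset
  intro μ hμ
  have hμ' : μ + 1 ∈ spectrum K T := by
    have : T - 1 = T - algebraMap K (Module.End K W) 1 := by rw [map_one]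
    rw [this, ← spectrum.sub_singleton_eq] at hμ
    simpa [sub_eq_iff_eq_add] using hμ
  -- Every spectral value is an N-th power of a spectral value, hence 1.
  rw [hpow N hN] at hμ'
  obtain ⟨ν, hν, hνμ⟩ := hμ'
  simp only [h1 ν hν] at hνμ
  simpa using hνμ

open TensorProduct in
/-- An invertible operator on a finite-dimensional real space that has, for every `n ≥ 1`, an
`n`-th root conjugate to itself is unipotent. -/
theorem Module.End.isNilpotent_sub_one_of_roots {W : Type*}
    [AddCommGroup W] [Module ℝ W] [FiniteDimensional ℝ W] (T : Module.End ℝ W)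
    (hT : IsUnit T) (S : ℕ → Module.End ℝ W) (U : ℕ → (Module.End ℝ W)ˣ)
    (hS : ∀ n, 0 < n → S n ^ n = T) (hU : ∀ n, 0 < n → S n = U n * T * ↑(U n)⁻¹) :
    IsNilpotent (T - 1) := by
  -- Complexification is injective on endomorphisms, so nilpotency descends to ℝ.
  let φ := Module.End.baseChangeHom ℝ ℂ W
  have hφ : Function.Injective φ := fun a b hab =>
    LinearMap.ext fun w => Module.FaithfullyFlat.tensorProduct_mk_injective (A := ℝ) (B := ℂ) W
      (LinearMap.congr_fun hab (1 ⊗ₜ[ℝ] w))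
  rw [← IsNilpotent.map_iff hφ, map_sub, map_one]
  refine Module.End.isNilpotent_sub_one_of_roots_of_isAlgClosed (φ T) (hT.map φ)
    (fun n => φ (S n)) (fun n => Units.map (φ : _ →* _) (U n)) (fun n hn => ?_) (fun n hn => ?_)
  · rw [← map_pow, hS n hn]
  · rw [hU n hn, map_mul, map_mul, ← map_inv]; rfl

/-! ### From vanishing differences to polynomials -/

open Polynomial in
/-- Newton's formula: along an arithmetic progression, a function killed by `Δ_h ^ m` is given by
a polynomial of degree less than `m`. -/
theorem exists_polynomial_of_fwdDiff_iter_eq_zero {g : ℝ → ℝ} {h : ℝ} {m : ℕ}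
    (hg : (fwdDiff h)^[m] g = 0) (y : ℝ) :
    ∃ Q : ℝ[X], Q.degree < m ∧ ∀ n : ℕ, g (y + n * h) = Q.eval (n : ℝ) := by
  have hz : ∀ k, m ≤ k → (fwdDiff h)^[k] g = 0 := by
    intro k hk
    obtain ⟨j, rfl⟩ := Nat.exists_eq_add_of_le' hk
    rw [Function.iterate_add_apply, hg]
    exact Function.iterate_fixed (by ext; simp [fwdDiff]) j
  refine ⟨∑ k ∈ Finset.range m, C ((fwdDiff h)^[k] g y / k.factorial) * descPochhammer ℝ k,
    ?_, fun n => ?_⟩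
  · rw [degree_lt_iff_coeff_zero]
    intro j hj
    rw [finsetSum_coeff]
    refine Finset.sum_eq_zero fun k hk => ?_
    rw [coeff_C_mul, coeff_eq_zero_of_natDegree_lt, mul_zero]
    rw [descPochhammer_natDegree]
    exact (Finset.mem_range.1 hk).trans_le hj
  · have hshift := shift_eq_sum_fwdDiff_iter h g n y
    rw [nsmul_eq_mul] at hshift
    rw [hshift, eval_finsetSum]
    have hterm : ∀ k, eval (n : ℝ) (C ((fwdDiff h)^[k] g y / k.factorial) * descPochhammer ℝ k)
        = n.choose k • (fwdDiff h)^[k] g y := by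
      intro k
      rw [eval_mul, eval_C, nsmul_eq_mul, Nat.cast_choose_eq_descPochhammer_div]
      ring
    simp_rw [hterm]
    rcases le_total m (n + 1) with hmn | hmn
    · refine (Finset.sum_subset (Finset.range_mono hmn) fun k _ hk => ?_).symm
      simp [hz k (by simpa using hk)]
    · refine Finset.sum_subset (Finset.range_mono hmn) fun k _ hk => ?_
      have : n < k := by simpa using hk
      simp [Nat.choose_eq_zero_of_lt this]

open Polynomial in
/-- **Fréchet's theorem**: a continuous function on the line killed by all `Δ_h ^ m` is a
polynomial of degree less than `m`; it is given by Lagrange interpolation. -/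
theorem eq_interpolate_of_fwdDiff_iter_eq_zero {g : ℝ → ℝ} (hc : Continuous g) {m : ℕ}
    (hg : ∀ h, (fwdDiff h)^[m] g = 0) (x : ℝ) :
    g x = (Lagrange.interpolate (Finset.range m) (fun k : ℕ => (k : ℝ)) fun k => g k).eval x := by
  set q := Lagrange.interpolate (Finset.range m) (fun k : ℕ => (k : ℝ)) fun k => g k
  suffices h : g = fun x => q.eval x from congrFun h x
  refine Continuous.ext_on Rat.isDenseEmbedding_coe_real.dense hc q.continuous ?_
  rintro _ ⟨z, rfl⟩
  -- The progression from -M with step 1/z.den meets both z and all the nodes 0, …, m - 1.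
  obtain ⟨M, hM⟩ : ∃ M : ℕ, -z.num ≤ M := ⟨z.num.natAbs, by omega⟩
  have hN : (0 : ℝ) < z.den := by exact_mod_cast z.den_pos
  obtain ⟨Q, hQd, hQ⟩ := exists_polynomial_of_fwdDiff_iter_eq_zero (hg (1 / z.den))
    (-(M : ℝ))
  have hgrid : ∀ a : ℤ, 0 ≤ (M : ℤ) * z.den + a →
      g ((a : ℝ) / z.den) = (Q.comp (C (z.den : ℝ) * (X + C (M : ℝ)))).eval ((a : ℝ) / z.den) := by
    intro a ha
    obtain ⟨n, hn⟩ := Int.eq_ofNat_of_zero_le ha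
    have hn' : (M : ℝ) * z.den + a = n := by exact_mod_cast hn
    have := hQ n
    rw [eval_comp, eval_mul, eval_add, eval_X, eval_C, eval_C]
    have hx : (a : ℝ) / z.den = -(M : ℝ) + n * (1 / z.den) := by
      rw [← hn']; field_simp; ring
    have hy : (z.den : ℝ) * ((a : ℝ) / z.den + M) = n := by
      rw [← hn']; field_simp; ring
    rw [hy, hx, this]
  have hdeg : (Q.comp (C (z.den : ℝ) * (X + C (M : ℝ)))).degree < m := by
    rcases eq_or_ne Q 0 with rfl | hQ0
    · simp
    have hlin : (C (z.den : ℝ) * (X + C (M : ℝ))).natDegree ≤ 1 :=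
      (natDegree_C_mul_le _ _).trans (natDegree_X_add_C _).le
    refine degree_le_natDegree.trans_lt (Nat.cast_lt.2 ?_)
    calc _ ≤ Q.natDegree * 1 := natDegree_comp_le.trans (Nat.mul_le_mul_left _ hlin)
      _ < m := by rwa [mul_one, natDegree_lt_iff_degree_lt hQ0]
  -- Degree below m and agreement at the m nodes identify the polynomial, whatever z is.
  have heq : Q.comp (C (z.den : ℝ) * (X + C (M : ℝ))) = q :=
    Lagrange.eq_interpolate_of_eval_eq (s := Finset.range m)
    (v := fun k : ℕ => (k : ℝ)) (fun k => g k) (fun a _ b _ h => by simpa using h)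
    (by simpa using hdeg) (fun k _ => by
      have := hgrid (k * z.den) (by positivity)
      have hk : (((k * z.den : ℤ) : ℝ) / z.den) = k := by push_cast; field_simp
      rw [hk] at this
      exact this.symm)
  have hz := hgrid z.num (by
    have h1 : (1 : ℤ) ≤ z.den := by exact_mod_cast z.den_pos
    have h2 : -z.num ≤ (M : ℤ) := by omega
    nlinarith [Int.natCast_nonneg M])
  rw [heq, ← Rat.cast_def] at hz
  exact hz

/-- A function of finitely many variables that is, in each variable separately, given by Lagrange
interpolation at `0, …, m - 1`, is a polynomial. -/
theorem exists_mvPolynomial_of_interpolate {ι : Type*} [Fintype ι] [DecidableEq ι] (m : ℕ)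
    (F : (ι → ℝ) → ℝ)
    (hF : ∀ i x, F x = (Lagrange.interpolate (Finset.range m) (fun k : ℕ => (k : ℝ))
      fun k => F (Function.update x i k)).eval (x i)) :
    ∃ p : MvPolynomial ι ℝ, ∀ x, F x = MvPolynomial.eval x p := by
  -- Coordinates outside s are frozen at y; y stays general so that a coordinate can be frozen at
  -- each node.
  suffices H : ∀ s : Finset ι, ∀ y : ι → ℝ, ∃ p : MvPolynomial ι ℝ, ∀ x : ι → ℝ,
      F (s.piecewise x y) = MvPolynomial.eval x p by
    simpa using H Finset.univ 0
  intro s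
  induction s using Finset.induction_on with
  | empty => exact fun y => ⟨MvPolynomial.C (F y), by simp⟩
  | insert i s hi ih =>
    intro y
    choose p hp using fun k : ℕ => ih (Function.update y i k)
    refine ⟨∑ k ∈ Finset.range m, p k * Polynomial.aeval (MvPolynomial.X i)
      (Lagrange.basis (Finset.range m) (fun k : ℕ => (k : ℝ)) k), fun x => ?_⟩
    rw [hF i, Lagrange.interpolate_apply, Polynomial.eval_finsetSum, map_sum]
    refine Finset.sum_congr rfl fun k _ => ?_
    rw [Polynomial.eval_mul, Polynomial.eval_C, map_mul, ← hp]
    congr 2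
    · ext j
      rcases eq_or_ne j i with rfl | hj
      · simp [hi]
      · simp [Finset.piecewise, hj]
    · have : (MvPolynomial.eval x) =
          ((MvPolynomial.aeval x : MvPolynomial ι ℝ →ₐ[ℝ] ℝ) : _ →+* ℝ) := by
        ext <;> simp
      rw [this, RingHom.coe_coe, ← Polynomial.aeval_algHom_apply]
      simp [Polynomial.aeval_def, Polynomial.eval₂_eq_eval_map]

/-! ### Translations and dilations acting on V -/

/-- Translation by `h` as an operator on a translation invariant space. -/
def translationEnd {ι : Type*} {V : Submodule ℝ C(ι → ℝ, ℝ)} (hV : TranslationInvariant V)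
    (h : ι → ℝ) : Module.End ℝ V where
  toFun f := ⟨translationOp h f, hV h f f.2⟩
  map_add' _ _ := rfl
  map_smul' _ _ := rfl

theorem translationEnd_apply {ι : Type*} {V : Submodule ℝ C(ι → ℝ, ℝ)}
    (hV : TranslationInvariant V) (h : ι → ℝ) (f : V) (x : ι → ℝ) :
    (translationEnd hV h f : C(ι → ℝ, ℝ)) x = (f : C(ι → ℝ, ℝ)) (x + h) := rfl

theorem translationEnd_zero {ι : Type*} {V : Submodule ℝ C(ι → ℝ, ℝ)}
    (hV : TranslationInvariant V) : translationEnd hV 0 = 1 := by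
  ext f x
  simp [translationEnd_apply]

theorem translationEnd_mul {ι : Type*} {V : Submodule ℝ C(ι → ℝ, ℝ)}
    (hV : TranslationInvariant V) (a b : ι → ℝ) :
    translationEnd hV a * translationEnd hV b = translationEnd hV (a + b) := by
  ext f x
  simp [translationEnd_apply, add_assoc]

theorem translationEnd_pow {ι : Type*} {V : Submodule ℝ C(ι → ℝ, ℝ)}
    (hV : TranslationInvariant V) (a : ι → ℝ) (n : ℕ) :
    translationEnd hV a ^ n = translationEnd hV (n • a) := by
  induction n with
  | zero => simp [translationEnd_zero]
  | succ n ih => rw [pow_succ, ih, translationEnd_mul, succ_nsmul]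

theorem isUnit_translationEnd {ι : Type*} {V : Submodule ℝ C(ι → ℝ, ℝ)}
    (hV : TranslationInvariant V) (h : ι → ℝ) : IsUnit (translationEnd hV h) :=
  ⟨⟨translationEnd hV h, translationEnd hV (-h),
    by rw [translationEnd_mul, add_neg_cancel, translationEnd_zero],
    by rw [translationEnd_mul, neg_add_cancel, translationEnd_zero]⟩, rfl⟩

/-- The symplectic map that multiplies the first `d` coordinates by `c` and the last `d`
coordinates by `c⁻¹`. -/
noncomputable def symplecticDilation (d : ℕ) (c : ℝ) :
    Matrix (Fin d ⊕ Fin d) (Fin d ⊕ Fin d) ℝ :=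
  Matrix.diagonal (Sum.elim (fun _ => c) fun _ => c⁻¹)

theorem symplecticDilation_mem (d : ℕ) {c : ℝ} (hc : c ≠ 0) :
    symplecticDilation d c ∈ Matrix.symplecticGroup (Fin d) ℝ := by
  rw [SymplecticGroup.mem_iff, symplecticDilation, Matrix.diagonal_transpose]
  ext i j
  rw [Matrix.mul_diagonal, Matrix.diagonal_mul]
  rcases i with i | i <;> rcases j with j | j <;>
    simp only [Matrix.J, Matrix.fromBlocks_apply₁₁, Matrix.fromBlocks_apply₁₂,
      Matrix.fromBlocks_apply₂₁, Matrix.fromBlocks_apply₂₂, Sum.elim_inl, Sum.elim_inr,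
      Matrix.zero_apply, mul_zero, zero_mul] <;> field_simp

/-- The action of `symplecticDilation d c` on an invariant space. -/
noncomputable def dilationUnit {d : ℕ} {V : Submodule ℝ C(Fin d ⊕ Fin d → ℝ, ℝ)}
    (hV : SymplecticInvariant V) {c : ℝ} (hc : c ≠ 0) : (Module.End ℝ V)ˣ where
  val :=
    { toFun := fun f => ⟨matrixOp (symplecticDilation d c) f,
        hV _ (symplecticDilation_mem d hc) f f.2⟩
      map_add' := fun _ _ => rfl
      map_smul' := fun _ _ => rfl }
  inv :=
    { toFun := fun f => ⟨matrixOp (symplecticDilation d c⁻¹) f,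
        hV _ (symplecticDilation_mem d (inv_ne_zero hc)) f f.2⟩
      map_add' := fun _ _ => rfl
      map_smul' := fun _ _ => rfl }
  val_inv := by
    ext f x
    refine congrArg (f : C(Fin d ⊕ Fin d → ℝ, ℝ)) ?_
    ext (i | i) <;> simp [symplecticDilation, Matrix.mulVec_diagonal, hc]
  inv_val := by
    ext f x
    refine congrArg (f : C(Fin d ⊕ Fin d → ℝ, ℝ)) ?_
    ext (i | i) <;> simp [symplecticDilation, Matrix.mulVec_diagonal, hc]

theorem translationEnd_mul_dilationUnit {d : ℕ} {V : Submodule ℝ C(Fin d ⊕ Fin d → ℝ, ℝ)}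
    (hT : TranslationInvariant V) (hV : SymplecticInvariant V) {c : ℝ} (hc : c ≠ 0)
    (h : Fin d ⊕ Fin d → ℝ) :
    translationEnd hT h * dilationUnit hV hc =
      dilationUnit hV hc * translationEnd hT ((symplecticDilation d c).mulVec h) := by
  ext f x
  exact congrArg (f : C(Fin d ⊕ Fin d → ℝ, ℝ)) (Matrix.mulVec_add _ x h)

/-- Axis vectors are eigenvectors of the dilations, so a dilation by n or n⁻¹ conjugates translation
by t to translation by t/n. -/
theorem isNilpotent_translationEnd_single_sub_one {d : ℕ}
    {V : Submodule ℝ C(Fin d ⊕ Fin d → ℝ, ℝ)} [FiniteDimensional ℝ V]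
    (hT : TranslationInvariant V) (hV : SymplecticInvariant V) (i : Fin d ⊕ Fin d) (t : ℝ) :
    IsNilpotent (translationEnd hT (Pi.single i t) - 1) := by
  have key : ∀ n : ℕ, ∃ U : (Module.End ℝ V)ˣ, 0 < n →
      translationEnd hT (Pi.single i (t / n)) =
        U * translationEnd hT (Pi.single i t) * ↑U⁻¹ := by
    intro n
    rcases n.eq_zero_or_pos with rfl | hn
    · exact ⟨1, fun h => absurd h (lt_irrefl 0)⟩
    have hn0 : (n : ℝ) ≠ 0 := by exact_mod_cast hn.ne'
    obtain ⟨c, hc, hci⟩ : ∃ c : ℝ, c ≠ 0 ∧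
        (symplecticDilation d c).mulVec (Pi.single i (t / n)) = Pi.single i t := by
      rcases i with i | i
      · refine ⟨n, hn0, ?_⟩
        rw [symplecticDilation, Matrix.diagonal_mulVec_single, Sum.elim_inl,
          mul_div_cancel₀ _ hn0]
      · refine ⟨(n : ℝ)⁻¹, inv_ne_zero hn0, ?_⟩
        rw [symplecticDilation, Matrix.diagonal_mulVec_single, Sum.elim_inr, inv_inv,
          mul_div_cancel₀ _ hn0]
    refine ⟨dilationUnit hV hc, fun _ => ?_⟩
    rw [Units.eq_mul_inv_iff_mul_eq, translationEnd_mul_dilationUnit, hci]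
  choose U hU using key
  refine Module.End.isNilpotent_sub_one_of_roots _ (isUnit_translationEnd hT _)
    (fun n => translationEnd hT (Pi.single i (t / n))) U (fun n hn => ?_) hU
  have hn0 : (n : ℝ) ≠ 0 := by exact_mod_cast hn.ne'
  rw [translationEnd_pow, ← Pi.single_smul, nsmul_eq_mul, mul_div_cancel₀ _ hn0]

/-- Turns nilpotency on V into vanishing differences along a line. -/
theorem translationEnd_sub_one_pow_apply {ι : Type*} [DecidableEq ι]
    {V : Submodule ℝ C(ι → ℝ, ℝ)} (hV : TranslationInvariant V) (i : ι) (h : ℝ) (x : ι → ℝ)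
    (m : ℕ) (f : V) (s : ℝ) :
    (((translationEnd hV (Pi.single i h) - 1) ^ m) f : C(ι → ℝ, ℝ)) (Function.update x i s) =
      (fwdDiff h)^[m] (fun s => (f : C(ι → ℝ, ℝ)) (Function.update x i s)) s := by
  induction m generalizing f with
  | zero => rfl
  | succ m ih =>
    rw [pow_succ, Module.End.mul_apply, ih, Function.iterate_succ_apply]
    refine congrArg (fun u => (fwdDiff h)^[m] u s) ?_
    ext s
    have : Function.update x i s + Pi.single i h = Function.update x i (s + h) := by
      ext j
      rcases eq_or_ne j i with rfl | hj <;> simp [*]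
    simp [fwdDiff, translationEnd_apply, this]

theorem theorem4p2 (d : ℕ) (V : Submodule ℝ C(Fin d ⊕ Fin d → ℝ, ℝ))
    (hfin : FiniteDimensional ℝ V) (htrans : TranslationInvariant V)
    (hsymp : SymplecticInvariant V) (f : C(Fin d ⊕ Fin d → ℝ, ℝ)) (hf : f ∈ V) :
    IsOrdinaryPolynomial f := by
  refine exists_mvPolynomial_of_interpolate (Module.finrank ℝ V) f fun i x => ?_
  have hzero : ∀ h : ℝ, (fwdDiff h)^[Module.finrank ℝ V]
      (fun s => f (Function.update x i s)) = 0 := by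
    intro h
    ext s
    -- By Cayley–Hamilton the exponent dim V serves all i and h at once, as interpolation on fixed
    -- nodes requires.
    have hnil := LinearMap.isNilpotent_iff_charpoly _ |>.1
      (isNilpotent_translationEnd_single_sub_one htrans hsymp i h)
    have hpow := LinearMap.aeval_self_charpoly (translationEnd htrans (Pi.single i h) - 1)
    rw [hnil, map_pow, Polynomial.aeval_X] at hpow
    rw [← translationEnd_sub_one_pow_apply htrans i h x _ ⟨f, hf⟩ s, hpow]
    rfl
  have hc : Continuous fun s => f (Function.update x i s) :=
    f.continuous.comp (continuous_const.update i continuous_id)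
  simpa using eq_interpolate_of_fwdDiff_iter_eq_zero hc hzero (x i)
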